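/- Let $G(x)=\frac1{4\pi}e^{-|x|^2/4}$ and $\mathbf v^G(x)=\frac1{2\pi}\frac{x^\perp}{|x|^2}\bigl(1-e^{-|x|^2/4}\bigr)$ for $x\in\mathbb R^2$, where $x^\perp=(-x_2,x_1)$ and $\mathbf v^G(0)=0$. Let $\mathcal M=\frac12(x_1\partial_1-x_2\partial_2)$, and for $w\in\mathcal S(\mathbb R^2)$ (real-valued Schwartz functions) let $$\Lambda w=\mathbf v^G\cdot\nabla w+\mathbf v\cdot\nabla G,\qquad \mathbf v(x)=\frac1{2\pi}\int_{\mathbb R^2}\frac{(x-y)^\perp}{|x-y|^2}\,w(y)\,dy .$$ Let $h(r)=\frac{r^2/4}{e^{r^2/4}-1}$ for $r>0$. **Proposition 3.1.** There is a unique function $\Omega:[0,\infty)\to\mathbb R$, continuous on $[0,\infty)$ and of class $C^2$ on $(0,\infty)$, that solves the Moffatt–Kida–Ohkitani equation $$-\frac1r\bigl(r\Omega'(r)\bigr)'+\Bigl(\frac4{r^2}-h(r)\Bigr)\Omega(r)=-\frac{r^2h(r)}4,\qquad r>0,$$ with the boundary conditions $\Omega(0)=0$ and $\lim_{r\to+\infty}\Omega(r)=0$.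 Moreover there exists $w_\infty\in\mathcal S(\mathbb R^2)$ of the form $$w_\infty(r\cos\theta,r\sin\theta)=\omega(r)\sin(2\theta),\qquad \omega(r)=h(r)\Bigl(\Omega(r)-\frac{r^2}4\Bigr)\ (r>0),\quad \omega(0)=0,$$ such that the integral defining its velocity field $\mathbf v$ converges absolutely for every $x\in\mathbb R^2$ and $$\Lambda w_\infty=\mathcal M G\quad\text{on }\mathbb R^2 .$$ -/

import Mathlib

open Real Set Filter Topology MeasureTheory
open scoped SchwartzMap ContDiff

namespace BurgersVortex

noncomputable section

/-- The Euclidean plane `ℝ²`; the components of `x` are `x 0` and `x 1`. -/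
abbrev Plane : Type := EuclideanSpace ℝ (Fin 2)

/-- The point of the plane with polar coordinates `(r, θ)`. -/
def polar (r θ : ℝ) : Plane := !₂[r * cos θ, r * sin θ]

/-- The rotated vector `x^⊥ = (-x₂, x₁)`. -/
def perp (x : Plane) : Plane := !₂[-x 1, x 0]

/-- The partial derivative `∂ᵢ f`. -/
def partialDeriv (i : Fin 2) (f : Plane → ℝ) (x : Plane) : ℝ :=
  fderiv ℝ f x (EuclideanSpace.single i 1)

/-- The convective derivative `(u · ∇) f` of `f` along the vector field `u`. -/
def convect (u : Plane → Plane) (f : Plane → ℝ) (x : Plane) : ℝ :=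
  ∑ i : Fin 2, u x i * partialDeriv i f x

/-- The Gaussian vorticity profile `G(x) = (4π)⁻¹ exp(-|x|²/4)`. -/
def G (x : Plane) : ℝ := 1 / (4 * π) * exp (-‖x‖ ^ 2 / 4)

/-- The velocity field `v^G(x) = (2π)⁻¹ (x^⊥ / |x|²) (1 - exp(-|x|²/4))`.
At `x = 0` the Lean formula gives `0`, which is the continuous extension. -/
def vG (x : Plane) : Plane :=
  (1 / (2 * π) * ((1 - exp (-‖x‖ ^ 2 / 4)) / ‖x‖ ^ 2)) • perp x

/-- The integrand of the Biot-Savart law, `w(y) (x - y)^⊥ / |x - y|²`. -/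
def biotSavartIntegrand (w : Plane → ℝ) (x y : Plane) : Plane :=
  (w y / ‖x - y‖ ^ 2) • perp (x - y)

/-- The velocity field obtained from the vorticity `w` by the Biot-Savart law,
`v(x) = (2π)⁻¹ ∫ w(y) (x - y)^⊥ / |x - y|² dy`. -/
def biotSavart (w : Plane → ℝ) (x : Plane) : Plane :=
  (1 / (2 * π)) • ∫ y : Plane, biotSavartIntegrand w x y

/-- The operator `Λ w = v^G · ∇w + v · ∇G`, with `v` the Biot-Savart velocity of `w`. -/
def Lam (w : Plane → ℝ) (x : Plane) : ℝ :=
  convect vG w x + convect (biotSavart w) G x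

/-- The operator `ℳ = (x₁ ∂₁ - x₂ ∂₂) / 2`. -/
def calM (f : Plane → ℝ) (x : Plane) : ℝ :=
  1 / 2 * (x 0 * partialDeriv 0 f x - x 1 * partialDeriv 1 f x)

/-- The function `h(r) = (r²/4) / (exp(r²/4) - 1)`, used for `r > 0`. -/
def h (r : ℝ) : ℝ := r ^ 2 / 4 / (exp (r ^ 2 / 4) - 1)

/-- `Ω : [0, ∞) → ℝ` (given as a function on `ℝ` whose values at negative arguments are
irrelevant) is a classical solution of the Moffatt-Kida-Ohkitani equation
`-(1/r) (r Ω')' + (4/r² - h) Ω = -r² h / 4` on `(0, ∞)`, continuous up to `r = 0`,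
with the boundary conditions `Ω(0) = Ω(+∞) = 0`. -/
structure IsMKOSolution (Ω : ℝ → ℝ) : Prop where
  contDiffOn : ContDiffOn ℝ 2 Ω (Ioi 0)
  ode : ∀ r : ℝ, 0 < r →
    -(1 / r) * deriv (fun s : ℝ => s * deriv Ω s) r + (4 / r ^ 2 - h r) * Ω r
      = -(r ^ 2 * h r / 4)
  continuousOn : ContinuousOn Ω (Ici 0)
  at_zero : Ω 0 = 0
  at_infinity : Tendsto Ω atTop (𝓝 0)

/-- The radial vorticity profile `ω(r) = h(r) (Ω(r) - r²/4)` built from `Ω`.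
If `Ω(0) = 0`, its value at `r = 0` is `0` whatever value is given to `h(0)`. -/
def radialVorticity (Ω : ℝ → ℝ) (r : ℝ) : ℝ := h r * (Ω r - r ^ 2 / 4)

end

end BurgersVortex

/-! In the variable s = r²/4, write Ω = s(1 - g). The Moffatt–Kida–Ohkitani equation becomes s g'' +
3g' + b g = 0 with b(s) = s/(e^s - 1), and g → 1 at infinity. Inverting -(s g'' + 3g') with the
kernel ½ min(1, σ²/s²) gives the fixed-point equation g = 1 + `greenOp` (b g). This is a contraction
on bounded continuous functions because ½∫b < ½∫e^{-s/2} = 1 (`exists_fixedPoint_greenOp`). The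
kernel also yields 1 - g = O(s⁻²), hence Ω → 0. Uniqueness is a maximum principle, based on h <
4/r².

The vorticity is w = -½ x₁x₂ b(s)g(s). Smoothness up to s = 0 comes from g' = -∫₀¹ t² (bg)(ts) dt,
which gains one derivative at each use. Every derivative of b is bounded by a multiple of b, so w is
Schwartz.

For Λw, since ∇G = -½Gx, only x·v matters. The Poisson formula evaluates its angular integral, which
turns out to be the same kernel min(1, σ²/s²). The radial integral is then `greenOp` (b g) = g - 1
itself, so x·v = ½(1 - g)(x₁² - x₂²) (`inner_biotSavart_wInf`). The transport term v^G·∇w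
contributes the share g of ℳG and v·∇G the share 1 - g. -/

namespace BurgersVortex

noncomputable section

/-! ### Weighted means on the half-line -/

/-- The weighted mean `∫₀¹ tᵐ q(ts) dt`. -/
def moment (m : ℕ) (q : ℝ → ℝ) (s : ℝ) : ℝ := ∫ t in (0 : ℝ)..1, t ^ m * q (t * s)

theorem continuous_comp_max_zero {q : ℝ → ℝ} (hq : ContinuousOn q (Ici 0)) :
    Continuous fun s => q (max s 0) :=
  hq.comp_continuous (by fun_prop) fun s => le_max_right s 0

theorem continuous_moment {q : ℝ → ℝ} (hq : Continuous q) (m : ℕ) : Continuous (moment m q) := by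
  unfold moment
  apply intervalIntegral.continuous_parametric_intervalIntegral_of_continuous'
  fun_prop

theorem moment_congr {q₁ q₂ : ℝ → ℝ} (hq : EqOn q₁ q₂ (Ici 0)) (m : ℕ) :
    EqOn (moment m q₁) (moment m q₂) (Ici 0) := by
  intro s hs
  refine intervalIntegral.integral_congr fun t ht => ?_
  rw [uIcc_of_le zero_le_one] at ht
  rw [hq (mul_nonneg ht.1 hs : 0 ≤ t * s)]

theorem moment_eq_comp_max (m : ℕ) (q : ℝ → ℝ) :
    EqOn (moment m q) (moment m fun s => q (max s 0)) (Ici 0) :=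
  moment_congr (fun s (hs : 0 ≤ s) => by simp [hs]) m

theorem continuousOn_moment {q : ℝ → ℝ} (hq : ContinuousOn q (Ici 0)) (m : ℕ) :
    ContinuousOn (moment m q) (Ici 0) :=
  ((continuous_moment (continuous_comp_max_zero hq) m).continuousOn).congr
    (moment_eq_comp_max m q)

theorem abs_moment_le {q : ℝ → ℝ} {C : ℝ} (hq : ∀ s, 0 ≤ s → |q s| ≤ C) (m : ℕ) {s : ℝ}
    (hs : 0 ≤ s) : |moment m q s| ≤ C := by
  have := intervalIntegral.norm_integral_le_of_norm_le_const (a := 0) (b := 1) (C := C)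
    (f := fun t => t ^ m * q (t * s)) (fun t ht => by
      rw [uIoc_of_le zero_le_one] at ht
      have h1 : |t ^ m| ≤ 1 := by
        rw [abs_of_nonneg (pow_nonneg ht.1.le m)]; exact pow_le_one₀ ht.1.le ht.2
      have h2 := hq (t * s) (mul_nonneg ht.1.le hs)
      rw [norm_mul, Real.norm_eq_abs, Real.norm_eq_abs]
      nlinarith [abs_nonneg (t ^ m), abs_nonneg (q (t * s))])
  simpa [moment] using this

theorem moment_eq_of_pos (m : ℕ) (q : ℝ → ℝ) {s : ℝ} (hs : 0 < s) :
    moment m q s = (s ^ (m + 1))⁻¹ * ∫ σ in (0 : ℝ)..s, σ ^ m * q σ := by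
  have h1 := intervalIntegral.integral_comp_mul_right (a := 0) (b := 1)
    (fun σ => σ ^ m * q σ) hs.ne'
  simp only [zero_mul, one_mul, smul_eq_mul] at h1
  rw [pow_succ, mul_inv, mul_assoc, ← h1, moment, ← intervalIntegral.integral_const_mul]
  refine intervalIntegral.integral_congr fun t _ => ?_
  simp only [mul_pow]
  field_simp

/-- Writing q as q(0) plus the integral of q' and exchanging integrals exhibits the mean as a
primitive of a continuous function, so the formula persists at the endpoint s = 0. -/
theorem hasDerivWithinAt_moment {q q' : ℝ → ℝ}
    (hq : ∀ s ∈ Ici (0 : ℝ), HasDerivWithinAt q (q' s) (Ici 0) s)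
    (hq' : ContinuousOn q' (Ici 0)) (m : ℕ) {s : ℝ} (hs : s ∈ Ici (0 : ℝ)) :
    HasDerivWithinAt (moment m q) (moment (m + 1) q' s) (Ici 0) s := by
  set p : ℝ → ℝ := fun s => q' (max s 0) with hp
  have hpc : Continuous p := continuous_comp_max_zero hq'
  have hqp : ∀ s, 0 ≤ s → q s = q 0 + ∫ τ in (0 : ℝ)..s, p τ := by
    intro s hs
    rw [intervalIntegral.integral_eq_sub_of_hasDeriv_right_of_le hs (f := q)]
    · ring
    · exact fun x hx => ((hq x hx.1).continuousWithinAt).mono Icc_subset_Ici_self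
    · intro x hx
      have : p x = q' x := by simp [hp, hx.1.le]
      rw [this]
      exact (hq x hx.1.le).mono fun y (hy : x < y) => (hx.1.trans hy).le
    · exact hpc.intervalIntegrable _ _
  have key : EqOn (moment m q)
      (fun s => (∫ t in (0 : ℝ)..1, t ^ m * q 0) + ∫ τ in (0 : ℝ)..s, moment (m + 1) p τ)
      (Ici 0) := by
    intro s hs
    have h1 : ∀ t ∈ uIcc (0 : ℝ) 1, t ^ m * q (t * s)
        = t ^ m * q 0 + ∫ τ in (0 : ℝ)..s, t ^ (m + 1) * p (t * τ) := by
      intro t ht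
      rw [uIcc_of_le zero_le_one] at ht
      rw [hqp _ (mul_nonneg ht.1 hs), mul_add, intervalIntegral.integral_const_mul]
      congr 1
      have := intervalIntegral.smul_integral_comp_mul_left (a := 0) (b := s) p t
      simp only [mul_zero, smul_eq_mul] at this
      rw [← this, pow_succ]
      ring
    have hc : Continuous (Function.uncurry fun t τ : ℝ => t ^ (m + 1) * p (t * τ)) := by
      fun_prop
    simp only [moment]
    rw [intervalIntegral.integral_congr h1, intervalIntegral.integral_add]
    · congr 1
      refine intervalIntegral_intervalIntegral_swap ?_
      exact (hc.continuousOn.integrableOn_compact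
        ((isCompact_uIcc (a := 0) (b := 1)).prod (isCompact_uIcc (a := 0) (b := s)))).mono_set
        (prod_mono uIoc_subset_uIcc uIoc_subset_uIcc)
    · exact Continuous.intervalIntegrable (by fun_prop) _ _
    · refine Continuous.intervalIntegrable ?_ _ _
      exact intervalIntegral.continuous_parametric_intervalIntegral_of_continuous' hc _ _
  rw [moment_eq_comp_max _ _ hs]
  refine HasDerivWithinAt.congr ?_ key (key hs)
  refine HasDerivAt.hasDerivWithinAt ?_
  have := ((continuous_moment hpc (m + 1)).integral_hasStrictDerivAt 0 s).hasDerivAt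
  exact this.const_add _

theorem derivWithin_moment {q : ℝ → ℝ} (hq : ContDiffOn ℝ 1 q (Ici 0)) (m : ℕ) :
    EqOn (derivWithin (moment m q) (Ici 0)) (moment (m + 1) (derivWithin q (Ici 0))) (Ici 0) := by
  intro s hs
  refine (hasDerivWithinAt_moment (fun t ht => ?_) ?_ m hs).derivWithin
    (uniqueDiffOn_Ici 0 s hs)
  · exact ((hq.differentiableOn one_ne_zero) t ht).hasDerivWithinAt
  · exact hq.continuousOn_derivWithin (uniqueDiffOn_Ici 0) le_rfl

theorem contDiffOn_moment (n : ℕ) : ∀ (m : ℕ) {q : ℝ → ℝ}, ContDiffOn ℝ n q (Ici 0) →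
    ContDiffOn ℝ n (moment m q) (Ici 0) := by
  induction n with
  | zero =>
    intro m q hq
    rw [Nat.cast_zero, contDiffOn_zero] at hq ⊢
    exact continuousOn_moment hq m
  | succ n ih =>
    intro m q hq
    have h1 : ContDiffOn ℝ 1 q (Ici 0) := hq.of_le (by norm_cast; omega)
    rw [Nat.cast_succ, contDiffOn_succ_iff_derivWithin (uniqueDiffOn_Ici 0)] at hq ⊢
    refine ⟨fun s hs => ?_, by simp, (ih (m + 1) hq.2.2).congr (derivWithin_moment h1 m)⟩
    exact (hasDerivWithinAt_moment (fun t ht => (hq.1 t ht).hasDerivWithinAt)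
      (h1.continuousOn_derivWithin (uniqueDiffOn_Ici 0) le_rfl) m hs).differentiableWithinAt

theorem iteratedDerivWithin_moment (n : ℕ) : ∀ (m : ℕ) {q : ℝ → ℝ}, ContDiffOn ℝ n q (Ici 0) →
    EqOn (iteratedDerivWithin n (moment m q) (Ici 0))
      (moment (m + n) (iteratedDerivWithin n q (Ici 0))) (Ici 0) := by
  induction n with
  | zero => intro m q _ s _; simp [iteratedDerivWithin_zero]
  | succ n ih =>
    intro m q hq s hs
    have h1 : ContDiffOn ℝ 1 q (Ici 0) := hq.of_le (by norm_cast; omega)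
    rw [Nat.cast_succ, contDiffOn_succ_iff_derivWithin (uniqueDiffOn_Ici 0)] at hq
    rw [iteratedDerivWithin_succ', iteratedDerivWithin_succ',
      iteratedDerivWithin_congr (derivWithin_moment h1 m) hs, ih (m + 1) hq.2.2 hs,
      show m + 1 + n = m + (n + 1) by ring]

/-! ### The function s/(e^s - 1): derivative bounds and integral -/

/-- The function `s / (exp s - 1)`, extended by `1` at `s = 0`. -/
def bose (s : ℝ) : ℝ := (moment 0 exp s)⁻¹

/-- Jensen's inequality: integrate over t the tangent-line bound for exp at s/2, whose linear term
has mean zero. -/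
theorem exp_half_le_moment_exp (s : ℝ) : exp (s / 2) ≤ moment 0 exp s := by
  have h1 : ∀ t : ℝ, exp (s / 2) * (1 + (t * s - s / 2)) ≤ t ^ 0 * exp (t * s) := by
    intro t
    have : exp (t * s) = exp (s / 2) * exp (t * s - s / 2) := by rw [← exp_add]; ring_nf
    rw [pow_zero, one_mul, this]
    have := add_one_le_exp (t * s - s / 2)
    gcongr
    linarith
  have h2 := intervalIntegral.integral_mono (a := 0) (b := 1) (μ := volume) zero_le_one
    (Continuous.intervalIntegrable (by fun_prop) _ _)
    (Continuous.intervalIntegrable (by fun_prop) _ _) h1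
  have h3 : ∫ t in (0 : ℝ)..1, exp (s / 2) * (1 + (t * s - s / 2)) = exp (s / 2) := by
    rw [intervalIntegral.integral_const_mul, intervalIntegral.integral_add,
      intervalIntegral.integral_sub, intervalIntegral.integral_mul_const]
    · simp; ring
    all_goals exact Continuous.intervalIntegrable (by fun_prop) _ _
  rw [h3] at h2
  exact h2

theorem moment_exp_pos (s : ℝ) : 0 < moment 0 exp s :=
  (exp_pos _).trans_le (exp_half_le_moment_exp s)

theorem moment_exp_eq {s : ℝ} (hs : s ≠ 0) : moment 0 exp s = (exp s - 1) / s := by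
  have := intervalIntegral.integral_comp_mul_right (a := 0) (b := 1) exp hs
  simp only [zero_mul, one_mul, smul_eq_mul, integral_exp, exp_zero] at this
  simp only [moment, pow_zero, one_mul, this]
  field_simp

theorem bose_eq {s : ℝ} (hs : s ≠ 0) : bose s = s / (exp s - 1) := by
  rw [bose, moment_exp_eq hs, inv_div]

theorem bose_pos (s : ℝ) : 0 < bose s := inv_pos.2 (moment_exp_pos s)

theorem bose_le (s : ℝ) : bose s ≤ exp (-(1 / 2) * s) := by
  rw [bose, show -(1 / 2) * s = -(s / 2) by ring, exp_neg]
  exact inv_anti₀ (exp_pos _) (exp_half_le_moment_exp s)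

/-- Since e^s - 1 = 2e^{s/2} sinh(s/2), this is s/2 < sinh(s/2). Strictness is what makes the later
contraction constant less than 1. -/
theorem bose_lt {s : ℝ} (hs : 0 < s) : bose s < exp (-(1 / 2) * s) := by
  have h1 : exp s - 1 = exp (s / 2) * (2 * sinh (s / 2)) := by
    rw [sinh_eq, mul_div_cancel₀ _ two_ne_zero, mul_sub, ← exp_add, ← exp_add]
    simp
  have h2 : s / 2 < sinh (s / 2) := self_lt_sinh_iff.2 (by positivity)
  have h3 := exp_pos (s / 2)
  rw [bose_eq hs.ne', h1, show -(1 / 2) * s = -(s / 2) by ring, exp_neg, div_lt_iff₀ (by nlinarith),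
    inv_mul_cancel_left₀ h3.ne']
  linarith

theorem continuous_bose : Continuous bose :=
  (continuous_moment continuous_exp 0).inv₀ fun s => (moment_exp_pos s).ne'

theorem contDiffOn_bose (n : ℕ) : ContDiffOn ℝ n bose (Ici 0) :=
  (contDiffOn_moment n 0 contDiff_exp.contDiffOn).inv fun s _ => (moment_exp_pos s).ne'

theorem iteratedDerivWithin_exp_Ici (n : ℕ) :
    EqOn (iteratedDerivWithin n exp (Ici 0)) exp (Ici 0) := fun s hs => by
  rw [iteratedDerivWithin_eq_iteratedDeriv (uniqueDiffOn_Ici 0) contDiff_exp.contDiffAt hs,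
    iteratedDeriv_eq_iterate, iter_deriv_exp]

theorem abs_iteratedDerivWithin_moment_exp_le (n : ℕ) {s : ℝ} (hs : 0 ≤ s) :
    |iteratedDerivWithin n (moment 0 exp) (Ici 0) s| ≤ moment 0 exp s := by
  rw [iteratedDerivWithin_moment n 0 contDiff_exp.contDiffOn hs,
    moment_congr (iteratedDerivWithin_exp_Ici n) _ hs, zero_add]
  have h0 : 0 ≤ moment n exp s := intervalIntegral.integral_nonneg zero_le_one fun t ht =>
    mul_nonneg (pow_nonneg ht.1 n) (exp_pos _).le
  rw [abs_of_nonneg h0]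
  refine intervalIntegral.integral_mono_on zero_le_one
    (Continuous.intervalIntegrable (by fun_prop) _ _)
    (Continuous.intervalIntegrable (by fun_prop) _ _) fun t ht => ?_
  refine mul_le_mul_of_nonneg_right ?_ (exp_pos _).le
  rw [pow_zero]
  exact pow_le_one₀ ht.1 ht.2

/-- Apply the Leibniz rule to `bose * moment 0 exp = 1` and solve for the top derivative of `bose`.
The derivatives of `moment 0 exp` are dominated by the function itself, which absorbs the factor
`bose`. -/
theorem abs_iteratedDerivWithin_bose_le (n : ℕ) :
    ∃ C, 0 ≤ C ∧ ∀ s, 0 ≤ s → |iteratedDerivWithin n bose (Ici 0) s| ≤ C * bose s := by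
  induction n using Nat.strong_induction_on with
  | _ n ih =>
    rcases Nat.eq_zero_or_pos n with rfl | hn
    · exact ⟨1, zero_le_one, fun s _ => by simp [abs_of_pos (bose_pos s)]⟩
    have ih' : ∀ i : ℕ, ∃ C, 0 ≤ C ∧ (i < n → ∀ s, 0 ≤ s →
        |iteratedDerivWithin i bose (Ici 0) s| ≤ C * bose s) := by
      intro i
      by_cases hi : i < n
      · obtain ⟨C, hC, h⟩ := ih i hi
        exact ⟨C, hC, fun _ => h⟩
      · exact ⟨0, le_rfl, fun h => absurd h hi⟩
    choose C hC0 hC using ih'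
    refine ⟨∑ i ∈ Finset.range n, n.choose i * C i,
      Finset.sum_nonneg fun i _ => mul_nonneg (Nat.cast_nonneg _) (hC0 i), fun s hs => ?_⟩
    have hE := moment_exp_pos s
    have hprod := iteratedDerivWithin_mul (n := n) (x := s) (mem_Ici.2 hs) (uniqueDiffOn_Ici (0 : ℝ))
      (contDiffOn_bose n s hs) (contDiffOn_moment n 0 contDiff_exp.contDiffOn s hs)
    have h1 : bose * moment 0 exp = fun _ => (1 : ℝ) := by
      ext t
      simp [bose, inv_mul_cancel₀ (moment_exp_pos t).ne']
    rw [h1, iteratedDerivWithin_const, if_neg hn.ne', Finset.sum_range_succ] at hprod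
    simp only [Nat.choose_self, Nat.cast_one, one_mul, Nat.sub_self,
      iteratedDerivWithin_zero] at hprod
    have h2 : iteratedDerivWithin n bose (Ici 0) s * moment 0 exp s
        = -∑ i ∈ Finset.range n, n.choose i * iteratedDerivWithin i bose (Ici 0) s *
            iteratedDerivWithin (n - i) (moment 0 exp) (Ici 0) s := by linarith
    have h3 : |iteratedDerivWithin n bose (Ici 0) s| * moment 0 exp s
        ≤ ∑ i ∈ Finset.range n, n.choose i * C i := by
      rw [← abs_of_pos hE, ← abs_mul, h2, abs_neg]
      refine (Finset.abs_sum_le_sum_abs _ _).trans (Finset.sum_le_sum fun i hi => ?_)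
      rw [abs_mul, abs_mul, Nat.abs_cast, mul_assoc]
      gcongr
      calc _ ≤ (C i * bose s) * moment 0 exp s := by
            gcongr
            · exact mul_nonneg (hC0 i) (bose_pos s).le
            · exact hC i (Finset.mem_range.1 hi) s hs
            · exact abs_iteratedDerivWithin_moment_exp_le _ hs
        _ = C i := by rw [bose, mul_assoc, inv_mul_cancel₀ hE.ne', mul_one]
    rw [bose, ← div_eq_mul_inv, le_div_iff₀ hE]
    exact h3

theorem integrableOn_exp_neg_half : IntegrableOn (fun s : ℝ => exp (-(1 / 2) * s)) (Ioi 0) :=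
  integrableOn_exp_mul_Ioi (by norm_num) 0

theorem integrableOn_of_abs_le_exp {φ : ℝ → ℝ} {C : ℝ} (hφ : Continuous φ)
    (hC : ∀ s, 0 ≤ s → |φ s| ≤ C * exp (-(1 / 2) * s)) : IntegrableOn φ (Ioi 0) := by
  refine Integrable.mono' (integrableOn_exp_neg_half.const_mul C) hφ.aestronglyMeasurable ?_
  exact (ae_restrict_iff' measurableSet_Ioi).2 (ae_of_all _ fun s hs => hC s (le_of_lt hs))

theorem integrableOn_bose : IntegrableOn bose (Ioi 0) :=
  integrableOn_of_abs_le_exp (C := 1) continuous_bose fun s _ => by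
    rw [abs_of_pos (bose_pos s), one_mul]; exact bose_le s

theorem integral_bose_lt_two : ∫ s in Ioi (0 : ℝ), bose s < 2 := by
  have h1 : ∫ s in Ioi (0 : ℝ), exp (-(1 / 2) * s) = 2 := by
    rw [integral_exp_mul_Ioi (by norm_num)]; norm_num
  have h2 : 0 < ∫ s in Ioi (0 : ℝ), (exp (-(1 / 2) * s) - bose s) := by
    rw [setIntegral_pos_iff_support_of_nonneg_ae
      (ae_of_all _ fun s => sub_nonneg.2 (bose_le s))
      (integrableOn_exp_neg_half.sub integrableOn_bose)]
    have : (Function.support fun s => exp (-(1 / 2) * s) - bose s) ∩ Ioi 0 = Ioi 0 :=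
      inter_eq_right.2 fun s hs => (sub_pos.2 (bose_lt hs)).ne'
    rw [this, Real.volume_Ioi]
    exact ENNReal.zero_lt_top
  rw [integral_sub integrableOn_exp_neg_half integrableOn_bose, h1] at h2
  linarith

/-! ### Green operator and fixed point -/

/-- The kernel `min(1, σ²/s²)` for `s, σ > 0`. -/
def greenKernel (s σ : ℝ) : ℝ := (σ / max s σ) ^ 2

/-- The integral operator inverting `-(s g'' + 3 g')` with `g(∞) = 0`. -/
def greenOp (φ : ℝ → ℝ) (s : ℝ) : ℝ := 1 / 2 * ∫ σ in Ioi (0 : ℝ), greenKernel s σ * φ σ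

theorem greenKernel_nonneg (s σ : ℝ) : 0 ≤ greenKernel s σ := sq_nonneg _

theorem greenKernel_le_one (s : ℝ) {σ : ℝ} (hσ : 0 < σ) : greenKernel s σ ≤ 1 := by
  have h1 : 0 < max s σ := lt_max_of_lt_right hσ
  exact pow_le_one₀ (by positivity) ((div_le_one h1).2 (le_max_right _ _))

theorem measurable_greenKernel (s : ℝ) : Measurable (greenKernel s) := by
  unfold greenKernel
  fun_prop

theorem continuous_greenKernel {σ : ℝ} (hσ : 0 < σ) : Continuous fun s => greenKernel s σ := by
  unfold greenKernel
  have : ∀ s, max s σ ≠ 0 := fun s => (lt_max_of_lt_right hσ).ne'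
  fun_prop (disch := assumption)

theorem abs_greenKernel_mul_le (s : ℝ) {σ : ℝ} (hσ : 0 < σ) (a : ℝ) :
    |greenKernel s σ * a| ≤ |a| := by
  rw [abs_mul, abs_of_nonneg (greenKernel_nonneg s σ)]
  exact mul_le_of_le_one_left (abs_nonneg a) (greenKernel_le_one s hσ)

theorem integrableOn_greenKernel_mul {φ : ℝ → ℝ} (hφ : IntegrableOn φ (Ioi 0)) (s : ℝ) :
    IntegrableOn (fun σ => greenKernel s σ * φ σ) (Ioi 0) := by
  refine Integrable.mono' hφ.abs
    ((measurable_greenKernel s).aestronglyMeasurable.mul hφ.aestronglyMeasurable) ?_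
  exact (ae_restrict_iff' measurableSet_Ioi).2
    (ae_of_all _ fun σ hσ => abs_greenKernel_mul_le s hσ _)

theorem continuous_greenOp {φ : ℝ → ℝ} (hφ : IntegrableOn φ (Ioi 0)) :
    Continuous (greenOp φ) := by
  refine continuous_const.mul (continuous_of_dominated (bound := fun σ => |φ σ|)
    (fun s => (integrableOn_greenKernel_mul hφ s).aestronglyMeasurable) (fun s => ?_) hφ.abs ?_)
  · exact (ae_restrict_iff' measurableSet_Ioi).2
      (ae_of_all _ fun σ hσ => abs_greenKernel_mul_le s hσ _)
  · exact (ae_restrict_iff' measurableSet_Ioi).2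
      (ae_of_all _ fun σ hσ => (continuous_greenKernel hσ).mul continuous_const)

theorem greenOp_sub {φ₁ φ₂ : ℝ → ℝ} (h₁ : IntegrableOn φ₁ (Ioi 0)) (h₂ : IntegrableOn φ₂ (Ioi 0))
    (s : ℝ) : greenOp (fun σ => φ₁ σ - φ₂ σ) s = greenOp φ₁ s - greenOp φ₂ s := by
  simp only [greenOp, mul_sub]
  rw [integral_sub (integrableOn_greenKernel_mul h₁ s) (integrableOn_greenKernel_mul h₂ s), mul_sub]

theorem abs_greenOp_le {φ ψ : ℝ → ℝ} (hψ : IntegrableOn ψ (Ioi 0)) (s : ℝ)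
    (hle : ∀ σ, 0 < σ → |greenKernel s σ * φ σ| ≤ ψ σ) :
    |greenOp φ s| ≤ 1 / 2 * ∫ σ in Ioi (0 : ℝ), ψ σ := by
  rw [greenOp, abs_mul, abs_of_pos (by norm_num : (0 : ℝ) < 1 / 2)]
  gcongr
  exact norm_integral_le_of_norm_le (f := fun σ => greenKernel s σ * φ σ) hψ
    ((ae_restrict_iff' measurableSet_Ioi).2 (ae_of_all _ fun σ hσ => hle σ hσ))

theorem abs_greenOp_bose_mul_le {u : ℝ → ℝ} {C : ℝ} (hC : ∀ s, |u s| ≤ C) (s : ℝ) :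
    |greenOp (fun σ => bose σ * u σ) s| ≤ (1 / 2 * ∫ σ in Ioi (0 : ℝ), bose σ) * C := by
  rw [mul_assoc, ← integral_mul_const]
  refine abs_greenOp_le (integrableOn_bose.mul_const C) s fun σ hσ => ?_
  refine (abs_greenKernel_mul_le s hσ _).trans ?_
  rw [abs_mul, abs_of_pos (bose_pos σ)]
  exact mul_le_mul_of_nonneg_left (hC σ) (bose_pos σ).le

theorem integrableOn_bose_mul {u : ℝ → ℝ} {C : ℝ} (hu : Continuous u) (hC : ∀ s, |u s| ≤ C) :
    IntegrableOn (fun σ => bose σ * u σ) (Ioi 0) := by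
  refine integrableOn_of_abs_le_exp (C := C) (continuous_bose.mul hu) fun s _ => ?_
  rw [abs_mul, abs_of_pos (bose_pos s), mul_comm]
  exact mul_le_mul (hC s) (bose_le s) (bose_pos s).le ((abs_nonneg _).trans (hC s))

open BoundedContinuousFunction in
theorem exists_fixedPoint_greenOp : ∃ u : ℝ → ℝ, Continuous u ∧ (∃ C, ∀ s, |u s| ≤ C) ∧
    ∀ s, u s = 1 + greenOp (fun σ => bose σ * u σ) s := by
  set κ : ℝ := 1 / 2 * ∫ σ in Ioi (0 : ℝ), bose σ with hκ
  have hκ0 : 0 ≤ κ := mul_nonneg (by norm_num)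
    (setIntegral_nonneg measurableSet_Ioi fun s _ => (bose_pos s).le)
  have hκ1 : κ < 1 := by have := integral_bose_lt_two; rw [hκ]; linarith
  have hb : ∀ u : ℝ →ᵇ ℝ, ∀ s, |u s| ≤ ‖u‖ := fun u s => u.norm_coe_le_norm s
  let T : (ℝ →ᵇ ℝ) → (ℝ →ᵇ ℝ) := fun u =>
    BoundedContinuousFunction.ofNormedAddCommGroup
      (fun s => 1 + greenOp (fun σ => bose σ * u σ) s)
      (continuous_const.add (continuous_greenOp (integrableOn_bose_mul u.continuous (hb u))))
      (1 + κ * ‖u‖) fun s => by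
        refine (norm_add_le _ _).trans ?_
        rw [norm_one]
        gcongr
        exact abs_greenOp_bose_mul_le (hb u) s
  have hTv : ∀ u s, T u s = 1 + greenOp (fun σ => bose σ * u σ) s := fun _ _ => rfl
  -- The kernel is at most 1, so the Lipschitz constant is half the integral of `bose`.
  have hT : ContractingWith ⟨κ, hκ0⟩ T := by
    refine ⟨by exact_mod_cast hκ1, LipschitzWith.of_dist_le_mul fun u v => ?_⟩
    refine (dist_le (by positivity)).2 fun s => ?_
    have h1 : T u s - T v s = greenOp (fun σ => bose σ * (u σ - v σ)) s := by
      simp only [mul_sub]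
      rw [greenOp_sub (integrableOn_bose_mul u.continuous (hb u))
        (integrableOn_bose_mul v.continuous (hb v))]
      rw [hTv, hTv]
      ring
    rw [Real.dist_eq, h1]
    exact abs_greenOp_bose_mul_le (fun s => u.dist_coe_le_dist s) s
  refine ⟨hT.fixedPoint, BoundedContinuousFunction.continuous _, ⟨_, hb _⟩, fun s => ?_⟩
  conv_lhs => rw [← hT.fixedPoint_isFixedPt]
  rfl

/-- Split at σ = s. The tail is written as total minus primitive, so that every s-dependent integral
is differentiable by the fundamental theorem. -/
theorem greenOp_eq_of_pos {φ : ℝ → ℝ} (hφi : IntegrableOn φ (Ioi 0)) {s : ℝ}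
    (hs : 0 < s) : greenOp φ s = 1 / 2 * ((s ^ 2)⁻¹ * (∫ σ in (0 : ℝ)..s, σ ^ 2 * φ σ)
      + ((∫ σ in Ioi (0 : ℝ), φ σ) - ∫ σ in (0 : ℝ)..s, φ σ)) := by
  have hsplit : ∀ ψ : ℝ → ℝ, IntegrableOn ψ (Ioi 0) →
      ∫ σ in Ioi (0 : ℝ), ψ σ = (∫ σ in Ioc 0 s, ψ σ) + ∫ σ in Ioi s, ψ σ := by
    intro ψ hψ
    rw [← Ioc_union_Ioi_eq_Ioi hs.le]
    exact setIntegral_union (Ioc_disjoint_Ioi le_rfl) measurableSet_Ioi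
      (hψ.mono_set Ioc_subset_Ioi_self) (hψ.mono_set (Ioi_subset_Ioi hs.le))
  have h1 : ∫ σ in Ioc 0 s, greenKernel s σ * φ σ = ∫ σ in Ioc 0 s, (s ^ 2)⁻¹ * (σ ^ 2 * φ σ) :=
    setIntegral_congr_fun measurableSet_Ioc fun σ hσ => by
      simp only [greenKernel, max_eq_left hσ.2, div_pow]; ring
  have h2 : ∫ σ in Ioi s, greenKernel s σ * φ σ = ∫ σ in Ioi s, φ σ :=
    setIntegral_congr_fun measurableSet_Ioi fun σ (hσ : s < σ) => by
      simp only [greenKernel, max_eq_right hσ.le, div_self (hs.trans hσ).ne', one_pow, one_mul]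
  rw [greenOp, hsplit _ (integrableOn_greenKernel_mul hφi s), hsplit _ hφi, h1, h2,
    integral_const_mul, intervalIntegral.integral_of_le hs.le, intervalIntegral.integral_of_le hs.le]
  ring

theorem hasDerivAt_greenOp {φ : ℝ → ℝ} (hφ : Continuous φ) (hφi : IntegrableOn φ (Ioi 0)) {s : ℝ}
    (hs : 0 < s) : HasDerivAt (greenOp φ) (-moment 2 φ s) s := by
  have h1 : HasDerivAt (fun s => ∫ σ in (0 : ℝ)..s, σ ^ 2 * φ σ) (s ^ 2 * φ s) s :=
    (Continuous.integral_hasStrictDerivAt (by fun_prop) 0 s).hasDerivAt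
  have h2 : HasDerivAt (fun s => ∫ σ in (0 : ℝ)..s, φ σ) (φ s) s :=
    (hφ.integral_hasStrictDerivAt 0 s).hasDerivAt
  have h3 : HasDerivAt (fun s : ℝ => (s ^ 2)⁻¹) (-(2 * s) / (s ^ 2) ^ 2) s := by
    simpa using (hasDerivAt_pow 2 s).fun_inv (by positivity)
  have h4 := ((h3.mul h1).add (h2.const_sub (∫ σ in Ioi (0 : ℝ), φ σ))).const_mul (1 / 2)
  refine (h4.congr_deriv ?_).congr_of_eventuallyEq ?_
  · rw [moment_eq_of_pos 2 φ hs]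
    field_simp
    ring
  · filter_upwards [lt_mem_nhds hs] with t ht
    exact greenOp_eq_of_pos hφi ht

theorem hasDerivWithinAt_greenOp {φ : ℝ → ℝ} (hφ : Continuous φ) (hφi : IntegrableOn φ (Ioi 0))
    {s : ℝ} (hs : s ∈ Ici (0 : ℝ)) :
    HasDerivWithinAt (greenOp φ) (-moment 2 φ s) (Ici 0) s := by
  rcases (mem_Ici.1 hs).eq_or_lt with rfl | hs
  · refine hasDerivWithinAt_Ici_of_tendsto_deriv (s := Ioi 0)
      (fun t ht => (hasDerivAt_greenOp hφ hφi ht).differentiableAt.differentiableWithinAt)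
      (continuous_greenOp hφi).continuousWithinAt self_mem_nhdsWithin ?_
    refine (((continuous_moment hφ 2).neg.tendsto 0).mono_left nhdsWithin_le_nhds).congr' ?_
    filter_upwards [self_mem_nhdsWithin] with t ht
    exact (hasDerivAt_greenOp hφ hφi ht).deriv.symm
  · exact (hasDerivAt_greenOp hφ hφi hs).hasDerivWithinAt

/-- Follows from `greenKernel s σ` ≤ σ²/s². This rate beats the factor s in Ω = s(1 - g). -/
theorem abs_greenOp_le_div_sq {φ : ℝ → ℝ} (hφ : IntegrableOn (fun σ => σ ^ 2 * |φ σ|) (Ioi 0))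
    {s : ℝ} (hs : 0 < s) :
    |greenOp φ s| ≤ (1 / 2 * ∫ σ in Ioi (0 : ℝ), σ ^ 2 * |φ σ|) / s ^ 2 := by
  rw [mul_div_assoc, div_eq_mul_inv _ (s ^ 2), ← integral_mul_const]
  refine abs_greenOp_le (hφ.mul_const _) s fun σ hσ => ?_
  rw [abs_mul, abs_of_nonneg (greenKernel_nonneg s σ), greenKernel, div_pow, mul_right_comm,
    ← div_eq_mul_inv]
  gcongr
  exact le_max_left _ _

/-! ### Regularity and decay of the amplitude g -/

/-- The bounded solution `g` of `s g'' + 3 g' + s / (exp s - 1) g = 0` with `g(∞) = 1`. -/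
def amp : ℝ → ℝ := exists_fixedPoint_greenOp.choose

/-- The function `s / (exp s - 1) * g(s)`. -/
def dens (s : ℝ) : ℝ := bose s * amp s

theorem continuous_amp : Continuous amp := exists_fixedPoint_greenOp.choose_spec.1

theorem exists_abs_amp_le : ∃ C, ∀ s, |amp s| ≤ C := exists_fixedPoint_greenOp.choose_spec.2.1

theorem amp_eq (s : ℝ) : amp s = 1 + greenOp dens s := exists_fixedPoint_greenOp.choose_spec.2.2 s

theorem continuous_dens : Continuous dens := continuous_bose.mul continuous_amp

theorem integrableOn_dens : IntegrableOn dens (Ioi 0) :=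
  integrableOn_bose_mul continuous_amp exists_abs_amp_le.choose_spec

theorem hasDerivWithinAt_amp {s : ℝ} (hs : s ∈ Ici (0 : ℝ)) :
    HasDerivWithinAt amp (-moment 2 dens s) (Ici 0) s :=
  ((hasDerivWithinAt_greenOp continuous_dens integrableOn_dens hs).const_add 1).congr
    (fun t _ => amp_eq t) (amp_eq s)

theorem hasDerivAt_amp {s : ℝ} (hs : 0 < s) : HasDerivAt amp (-moment 2 dens s) s :=
  (hasDerivWithinAt_amp hs.le).hasDerivAt (Ici_mem_nhds hs)

theorem derivWithin_amp : EqOn (derivWithin amp (Ici 0)) (fun s => -moment 2 dens s) (Ici 0) :=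
  fun s hs => (hasDerivWithinAt_amp hs).derivWithin (uniqueDiffOn_Ici 0 s hs)

/-- Bootstrap: g' is minus a weighted mean of b g, and such means preserve regularity. -/
theorem contDiffOn_amp (n : ℕ) : ContDiffOn ℝ n amp (Ici 0) := by
  induction n with
  | zero => exact contDiffOn_zero.2 continuous_amp.continuousOn
  | succ n ih =>
    rw [Nat.cast_succ, contDiffOn_succ_iff_derivWithin (uniqueDiffOn_Ici 0)]
    refine ⟨fun s hs => (hasDerivWithinAt_amp hs).differentiableWithinAt, by simp, ?_⟩
    exact (contDiffOn_moment n 2 ((contDiffOn_bose n).mul ih)).neg.congr derivWithin_amp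

theorem contDiffOn_dens (n : ℕ) : ContDiffOn ℝ n dens (Ici 0) :=
  (contDiffOn_bose n).mul (contDiffOn_amp n)

theorem abs_iteratedDerivWithin_dens_le_of_amp (n : ℕ)
    (hn : ∀ i ≤ n, ∃ C, ∀ s, 0 ≤ s → |iteratedDerivWithin i amp (Ici 0) s| ≤ C) :
    ∃ C, ∀ s, 0 ≤ s → |iteratedDerivWithin n dens (Ici 0) s| ≤ C * bose s := by
  choose! A hA using hn
  choose B hB0 hB using abs_iteratedDerivWithin_bose_le
  refine ⟨∑ i ∈ Finset.range (n + 1), n.choose i * B i * A (n - i), fun s hs => ?_⟩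
  have hprod := iteratedDerivWithin_mul (n := n) (x := s) (mem_Ici.2 hs)
    (uniqueDiffOn_Ici (0 : ℝ)) (contDiffOn_bose n s hs) (contDiffOn_amp n s hs)
  change |iteratedDerivWithin n (bose * amp) (Ici 0) s| ≤ _
  rw [hprod, Finset.sum_mul]
  refine (Finset.abs_sum_le_sum_abs _ _).trans (Finset.sum_le_sum fun i _ => ?_)
  rw [abs_mul, abs_mul, Nat.abs_cast]
  calc _ ≤ n.choose i * (B i * bose s) * A (n - i) := by
        gcongr
        · exact mul_nonneg (Nat.cast_nonneg _) (mul_nonneg (hB0 i) (bose_pos s).le)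
        · exact hB i s hs
        · exact hA _ (Nat.sub_le _ _) s hs
    _ = _ := by ring

theorem bose_le_one {s : ℝ} (hs : 0 ≤ s) : bose s ≤ 1 :=
  (bose_le s).trans (exp_le_one_iff.2 (by linarith))

/-- The derivative of order n + 1 of g is minus a weighted mean of the n-th derivative of b g, which
involves only lower derivatives of g. -/
theorem exists_abs_iteratedDerivWithin_amp_le (n : ℕ) :
    ∃ C, ∀ s, 0 ≤ s → |iteratedDerivWithin n amp (Ici 0) s| ≤ C := by
  induction n using Nat.strong_induction_on with
  | _ n ih =>
    rcases n with _ | n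
    · obtain ⟨C, hC⟩ := exists_abs_amp_le
      exact ⟨C, fun s _ => by simpa using hC s⟩
    obtain ⟨C, hC⟩ := abs_iteratedDerivWithin_dens_le_of_amp n fun i hi => ih i (by omega)
    refine ⟨|C|, fun s hs => ?_⟩
    rw [iteratedDerivWithin_succ', iteratedDerivWithin_congr derivWithin_amp hs,
      iteratedDerivWithin_fun_neg, abs_neg, iteratedDerivWithin_moment n 2 (contDiffOn_dens n) hs]
    refine abs_moment_le (fun t ht => (hC t ht).trans ?_) _ hs
    calc C * bose t ≤ |C| * 1 :=
          mul_le_mul (le_abs_self C) (bose_le_one ht) (bose_pos t).le (abs_nonneg C)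
      _ = |C| := mul_one _

theorem exists_abs_iteratedDerivWithin_dens_le (n : ℕ) :
    ∃ C, 0 ≤ C ∧ ∀ s, 0 ≤ s → |iteratedDerivWithin n dens (Ici 0) s| ≤ C * exp (-(1 / 2) * s) := by
  obtain ⟨C, hC⟩ := abs_iteratedDerivWithin_dens_le_of_amp n fun i _ =>
    exists_abs_iteratedDerivWithin_amp_le i
  refine ⟨|C|, abs_nonneg C, fun s hs => (hC s hs).trans ?_⟩
  exact mul_le_mul (le_abs_self C) (bose_le s) (bose_pos s).le (abs_nonneg C)

theorem integrableOn_sq_mul_abs_dens : IntegrableOn (fun σ => σ ^ 2 * |dens σ|) (Ioi 0) := by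
  obtain ⟨C, hC0, hC⟩ := exists_abs_iteratedDerivWithin_dens_le 0
  simp only [iteratedDerivWithin_zero] at hC
  have h1 : IntegrableOn (fun s : ℝ => exp (-(1 / 4) * s)) (Ioi 0) :=
    integrableOn_exp_mul_Ioi (by norm_num) 0
  have hc : Continuous fun σ => σ ^ 2 * |dens σ| := by have := continuous_dens; fun_prop
  refine Integrable.mono' (h1.const_mul (32 * C)) hc.aestronglyMeasurable ?_
  refine (ae_restrict_iff' measurableSet_Ioi).2 (ae_of_all _ fun s (hs : 0 < s) => ?_)
  rw [Real.norm_of_nonneg (by positivity)]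
  -- From (s/4)²/2 ≤ e^{s/4}; half of the exponential decay is spent on s².
  have h2 : s ^ 2 ≤ 32 * exp (s / 4) := by
    have := quadratic_le_exp_of_nonneg (show 0 ≤ s / 4 by positivity)
    nlinarith
  calc s ^ 2 * |dens s| ≤ (32 * exp (s / 4)) * (C * exp (-(1 / 2) * s)) := by
        gcongr
        exact hC s hs.le
    _ = 32 * C * (exp (s / 4) * exp (-(1 / 2) * s)) := by ring
    _ = _ := by rw [← exp_add]; ring_nf

theorem exists_abs_one_sub_amp_le : ∃ C, ∀ s, 0 < s → |1 - amp s| ≤ C / s ^ 2 :=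
  ⟨_, fun s hs => by
    rw [amp_eq, sub_add_cancel_left, abs_neg]
    exact abs_greenOp_le_div_sq integrableOn_sq_mul_abs_dens hs⟩

/-! ### From radial profiles to Schwartz functions -/

/-- The radial function `x ↦ φ(|x|²/4)`. -/
def radial (φ : ℝ → ℝ) (x : Plane) : ℝ := φ (‖x‖ ^ 2 / 4)

theorem hasTemperateGrowth_normSq_div_four :
    Function.HasTemperateGrowth fun x : Plane => ‖x‖ ^ 2 / 4 := by
  simp only [div_eq_mul_inv]
  fun_prop

theorem normSq_div_four_mem_Ici (x : Plane) : ‖x‖ ^ 2 / 4 ∈ Ici (0 : ℝ) := by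
  have : 0 ≤ ‖x‖ ^ 2 / 4 := by positivity
  exact this

theorem contDiff_radial {φ : ℝ → ℝ} (hφ : ∀ n : ℕ, ContDiffOn ℝ n φ (Ici 0)) :
    ContDiff ℝ ∞ (radial φ) := by
  rw [← contDiffOn_univ]
  exact (contDiffOn_infty.2 hφ).comp hasTemperateGrowth_normSq_div_four.1.contDiffOn
    fun x _ => normSq_div_four_mem_Ici x

theorem one_add_pow_mul_exp_le (m : ℕ) {r : ℝ} (hr : 0 ≤ r) :
    (1 + r) ^ m * exp (-(1 / 2) * (r ^ 2 / 4)) ≤ m.factorial * exp 3 := by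
  have h1 := pow_div_factorial_le_exp (1 + r) (by positivity) m
  rw [div_le_iff₀ (by positivity)] at h1
  calc (1 + r) ^ m * exp (-(1 / 2) * (r ^ 2 / 4))
      ≤ exp (1 + r) * m.factorial * exp (-(1 / 2) * (r ^ 2 / 4)) := by gcongr
    _ = m.factorial * exp (1 + r + -(1 / 2) * (r ^ 2 / 4)) := by
        rw [exp_add _ (-(1 / 2) * (r ^ 2 / 4))]; ring
    _ ≤ _ := by
        gcongr
        -- 1 + r - r²/8 = 3 - (r - 4)²/8.
        nlinarith [sq_nonneg (r - 4)]

/-- In the Faà di Bruno bound the inner function |x|²/4 contributes polynomial growth and the outer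
derivatives Gaussian decay. -/
theorem radial_decay {φ : ℝ → ℝ} (hφ : ∀ n : ℕ, ContDiffOn ℝ n φ (Ici 0))
    (hb : ∀ n : ℕ, ∃ C, 0 ≤ C ∧
      ∀ s, 0 ≤ s → |iteratedDerivWithin n φ (Ici 0) s| ≤ C * exp (-(1 / 2) * s)) (p n : ℕ) :
    ∃ C : ℝ, ∀ x, ‖x‖ ^ p * ‖iteratedFDeriv ℝ n (radial φ) x‖ ≤ C := by
  choose B hB0 hB using hb
  obtain ⟨k, A, hA0, hA⟩ := hasTemperateGrowth_normSq_div_four.norm_iteratedFDeriv_le_uniform n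
  refine ⟨n.factorial * (∑ i ∈ Finset.range (n + 1), B i) * (A + 1) ^ n *
    ((p + k * n).factorial * exp 3), fun x => ?_⟩
  have hx := norm_nonneg x
  have hs := normSq_div_four_mem_Ici x
  have hBs : 0 ≤ ∑ i ∈ Finset.range (n + 1), B i := Finset.sum_nonneg fun i _ => hB0 i
  -- The composition bound asks for D^i at order i; with D ≥ 1, a uniform bound by D suffices for i
  -- ≥ 1.
  have hD : 1 ≤ (A + 1) * (1 + ‖x‖) ^ k :=
    one_le_mul_of_one_le_of_one_le (by linarith) (one_le_pow₀ (by linarith))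
  have key := norm_iteratedFDeriv_comp_le' (𝕜 := ℝ) (g := φ) (n := n) (N := n)
    (f := fun x : Plane => ‖x‖ ^ 2 / 4)
    (t := Ici 0) (range_subset_iff.2 normSq_div_four_mem_Ici) (uniqueDiffOn_Ici 0) (hφ n)
    (hasTemperateGrowth_normSq_div_four.1.of_le (mod_cast le_top)) le_rfl x
    (C := (∑ i ∈ Finset.range (n + 1), B i) * exp (-(1 / 2) * (‖x‖ ^ 2 / 4)))
    (D := (A + 1) * (1 + ‖x‖) ^ k)
    (fun i hi => by
      rw [norm_iteratedFDerivWithin_eq_norm_iteratedDerivWithin]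
      refine (hB i _ hs).trans ?_
      gcongr
      exact Finset.single_le_sum (f := B) (fun j _ => hB0 j) (Finset.mem_range.2 (by omega)))
    (fun i hi1 hi => by
      refine (hA i hi x).trans (le_trans ?_ (le_self_pow₀ hD (by omega)))
      gcongr
      linarith)
  change ‖x‖ ^ p * ‖iteratedFDeriv ℝ n (φ ∘ fun x : Plane => ‖x‖ ^ 2 / 4) x‖ ≤ _
  calc _ ≤ (1 + ‖x‖) ^ p * (n.factorial * ((∑ i ∈ Finset.range (n + 1), B i) *
        exp (-(1 / 2) * (‖x‖ ^ 2 / 4))) * ((A + 1) * (1 + ‖x‖) ^ k) ^ n) := by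
        gcongr
        linarith
    _ = n.factorial * (∑ i ∈ Finset.range (n + 1), B i) * (A + 1) ^ n *
        ((1 + ‖x‖) ^ (p + k * n) * exp (-(1 / 2) * (‖x‖ ^ 2 / 4))) := by
        rw [pow_add, pow_mul, mul_pow]; ring
    _ ≤ _ := mul_le_mul_of_nonneg_left (one_add_pow_mul_exp_le _ hx) (by positivity)

/-- The radial function `x ↦ dens(|x|²/4)` as a Schwartz function. -/
def radialDens : 𝓢(Plane, ℝ) where
  toFun := radial dens
  smooth' := contDiff_radial contDiffOn_dens
  decay' := radial_decay contDiffOn_dens exists_abs_iteratedDerivWithin_dens_le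

theorem hasTemperateGrowth_coord_mul :
    Function.HasTemperateGrowth fun x : Plane => -(1 / 2 : ℝ) * (x 0 * x 1) := by
  have h : ∀ i : Fin 2, Function.HasTemperateGrowth fun x : Plane => x i :=
    fun i => (EuclideanSpace.proj (𝕜 := ℝ) i).hasTemperateGrowth
  exact (Function.HasTemperateGrowth.const _).mul ((h 0).mul (h 1))

/-- The vorticity `w(x) = -(x₁ x₂ / 2) dens(|x|²/4)`. -/
def wInf : 𝓢(Plane, ℝ) :=
  SchwartzMap.smulLeftCLM ℝ (fun x : Plane => -(1 / 2 : ℝ) * (x 0 * x 1)) radialDens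

theorem wInf_apply (x : Plane) : wInf x = -(1 / 2) * (x 0 * x 1) * dens (‖x‖ ^ 2 / 4) :=
  SchwartzMap.smulLeftCLM_apply_apply hasTemperateGrowth_coord_mul _ _

theorem norm_polar_sq (r θ : ℝ) : ‖polar r θ‖ ^ 2 = r ^ 2 := by
  rw [EuclideanSpace.norm_sq_eq]
  simp [polar, mul_pow, ← mul_add]

theorem wInf_polar (r θ : ℝ) :
    wInf (polar r θ) = -(r ^ 2 / 4 * dens (r ^ 2 / 4)) * sin (2 * θ) := by
  rw [wInf_apply, norm_polar_sq, sin_two_mul]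
  simp [polar]
  ring

/-! ### Existence for the Moffatt–Kida–Ohkitani equation -/

/-- The solution `Ω(r) = s (1 - g(s))`, `s = r²/4`, of the Moffatt-Kida-Ohkitani equation. -/
def mko (r : ℝ) : ℝ := r ^ 2 / 4 * (1 - amp (r ^ 2 / 4))

theorem h_eq_bose {r : ℝ} (hr : r ≠ 0) : h r = bose (r ^ 2 / 4) := by
  rw [bose_eq (by positivity), h]

theorem radialVorticity_mko (r : ℝ) :
    radialVorticity mko r = -(r ^ 2 / 4 * dens (r ^ 2 / 4)) := by
  rcases eq_or_ne r 0 with rfl | hr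
  · simp [radialVorticity, mko]
  · rw [radialVorticity, h_eq_bose hr, mko, dens]
    ring

theorem deriv_mko {r : ℝ} (hr : 0 < r) :
    HasDerivAt mko (r / 2 * (1 - amp (r ^ 2 / 4) + r ^ 2 / 4 * moment 2 dens (r ^ 2 / 4))) r := by
  have hs : 0 < r ^ 2 / 4 := by positivity
  have h1 : HasDerivAt (fun r : ℝ => r ^ 2 / 4) (r / 2) r := by
    refine ((hasDerivAt_pow 2 r).div_const 4).congr_deriv ?_
    norm_num; ring
  have h2 := h1.mul (((hasDerivAt_amp hs).comp r h1).const_sub 1)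
  refine h2.congr_deriv ?_
  simp only [Function.comp]
  ring

theorem hasDerivAt_mul_deriv_mko {r : ℝ} (hr : 0 < r) :
    HasDerivAt (fun s => s * deriv mko s)
      (r * (1 - amp (r ^ 2 / 4) + r ^ 2 / 4 * dens (r ^ 2 / 4))) r := by
  have hs : 0 < r ^ 2 / 4 := by positivity
  have h1 : HasDerivAt (fun r : ℝ => r ^ 2 / 4) (r / 2) r := by
    refine ((hasDerivAt_pow 2 r).div_const 4).congr_deriv ?_
    norm_num; ring
  have hP : HasDerivAt (fun s => ∫ σ in (0 : ℝ)..s, σ ^ 2 * dens σ)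
      ((r ^ 2 / 4) ^ 2 * dens (r ^ 2 / 4)) (r ^ 2 / 4) :=
    (Continuous.integral_hasStrictDerivAt
      ((continuous_id.pow 2).mul continuous_dens) 0 _).hasDerivAt
  -- This is rΩ' in terms of s. After differentiation the two terms s⁻²∫σ² `dens` cancel, and g'' is
  -- never needed.
  have hF : HasDerivAt (fun s => 2 * (s * (1 - amp s) + s⁻¹ * ∫ σ in (0 : ℝ)..s, σ ^ 2 * dens σ))
      (2 * (1 - amp (r ^ 2 / 4) + r ^ 2 / 4 * dens (r ^ 2 / 4))) (r ^ 2 / 4) := by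
    have := (((hasDerivAt_id (r ^ 2 / 4)).mul ((hasDerivAt_amp hs).const_sub 1)).add
      ((hasDerivAt_inv hs.ne').mul hP)).const_mul 2
    refine this.congr_deriv ?_
    rw [moment_eq_of_pos 2 dens hs]
    simp only [id]
    field_simp
    ring
  refine ((hF.comp r h1).congr_deriv ?_).congr_of_eventuallyEq ?_
  · ring
  · filter_upwards [lt_mem_nhds hr] with t ht
    have ht' : 0 < t ^ 2 / 4 := by positivity
    rw [(deriv_mko ht).deriv, moment_eq_of_pos 2 dens ht']
    simp only [Function.comp]
    field_simp
    ring

theorem isMKOSolution_mko : IsMKOSolution mko where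
  contDiffOn := by
    have h1 : ContDiffOn ℝ 2 (fun r : ℝ => r ^ 2 / 4) (Ioi 0) :=
      ContDiff.contDiffOn (by fun_prop)
    refine h1.mul (contDiffOn_const.sub ((contDiffOn_amp 2).comp h1 fun r _ => ?_))
    exact div_nonneg (sq_nonneg r) (by norm_num)
  ode := fun r hr => by
    rw [(hasDerivAt_mul_deriv_mko hr).deriv, h_eq_bose hr.ne', mko, dens]
    field_simp
    ring
  continuousOn := by
    have := continuous_amp
    unfold mko
    fun_prop
  at_zero := by simp [mko]
  at_infinity := by
    obtain ⟨C, hC⟩ := exists_abs_one_sub_amp_le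
    have h1 : Tendsto (fun r : ℝ => r ^ 2 / 4) atTop atTop :=
      (tendsto_pow_atTop two_ne_zero).atTop_div_const (by norm_num)
    have h2 : Tendsto (fun s : ℝ => s * (1 - amp s)) atTop (𝓝 0) := by
      have h3 : Tendsto (fun s : ℝ => C / s) atTop (𝓝 0) := tendsto_const_nhds.div_atTop tendsto_id
      refine squeeze_zero_norm' ?_ h3
      filter_upwards [eventually_gt_atTop 0] with s hs
      rw [norm_mul, Real.norm_of_nonneg hs.le]
      calc s * |1 - amp s| ≤ s * (C / s ^ 2) := by gcongr; exact hC s hs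
        _ = C / s := by field_simp
    exact h2.comp h1

/-! ### Uniqueness by the maximum principle -/

theorem h_lt_four_div_sq {r : ℝ} (hr : 0 < r) : h r < 4 / r ^ 2 := by
  have hs : 0 < r ^ 2 / 4 := by positivity
  have h1 := quadratic_le_exp_of_nonneg (x := r ^ 2 / 8) (by positivity)
  have h2 : exp (r ^ 2 / 4) = exp (r ^ 2 / 8) * exp (r ^ 2 / 8) := by rw [← exp_add]; ring_nf
  have h3 : (1 + r ^ 2 / 8 + (r ^ 2 / 8) ^ 2 / 2) * (1 + r ^ 2 / 8 + (r ^ 2 / 8) ^ 2 / 2)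
      ≤ exp (r ^ 2 / 4) := by
    rw [h2]; gcongr
  -- With u = r²/8, the squared quadratic bound exceeds 1 + 4u² by u((u - 1)² + 1) + u⁴/4 > 0.
  have h4 : (r ^ 2 / 4) ^ 2 < exp (r ^ 2 / 4) - 1 := by
    set u := r ^ 2 / 8 with hu
    have hu0 : 0 < u := by positivity
    rw [show r ^ 2 / 4 = 2 * u by rw [hu]; ring] at h3 ⊢
    nlinarith [mul_pos hu0 hu0, mul_nonneg hu0.le (sq_nonneg (u - 2)), pow_pos hu0 3,
      mul_nonneg hu0.le (sq_nonneg (u - 1))]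
  have h5 : 4 / r ^ 2 = (r ^ 2 / 4)⁻¹ := by field_simp
  rw [h, h5, div_lt_iff₀ (by nlinarith [sq_nonneg (r ^ 2 / 4)]), inv_mul_eq_div, lt_div_iff₀ hs]
  nlinarith

/-- Maximum principle: the difference of two solutions is nonpositive. -/
theorem IsMKOSolution.le {Ω₁ Ω₂ : ℝ → ℝ} (h₁ : IsMKOSolution Ω₁) (h₂ : IsMKOSolution Ω₂) {r : ℝ}
    (hr : 0 ≤ r) : Ω₁ r ≤ Ω₂ r := by
  by_contra! hlt
  set D : ℝ → ℝ := fun r => Ω₁ r - Ω₂ r with hD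
  have hDr : 0 < D r := sub_pos.2 hlt
  have hD0 : D 0 = 0 := by simp [hD, h₁.at_zero, h₂.at_zero]
  have hDc : ContinuousOn D (Ici 0) := h₁.continuousOn.sub h₂.continuousOn
  have hDinf : Tendsto D atTop (𝓝 0) := by simpa using h₁.at_infinity.sub h₂.at_infinity
  -- A positive value and the limit 0 at infinity force the supremum to be attained.
  obtain ⟨m, hm, hmax⟩ : ∃ m, 0 ≤ m ∧ ∀ s, 0 ≤ s → D s ≤ D m := by
    obtain ⟨m, hm, hmax⟩ := hDc.exists_isMaxOn' isClosed_Ici hr (by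
      rw [eventually_inf_principal]
      refine (Metric.cobounded_eq_cocompact (α := ℝ)) ▸ ?_
      rw [IsOrderBornology.cobounded_eq, eventually_sup]
      refine ⟨?_, (hDinf.eventually (gt_mem_nhds hDr)).mono fun s hs _ => hs.le⟩
      filter_upwards [eventually_lt_atBot (0 : ℝ)] with s hs hs'
      exact absurd hs' (not_le.2 hs))
    exact ⟨m, hm, fun s hs => hmax hs⟩
  have hDm : 0 < D m := hDr.trans_le (hmax r hr)
  have hm0 : 0 < m := hm.lt_of_ne fun h0 => by rw [← h0, hD0] at hDm; exact hDm.false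
  have hloc : IsLocalMax D m := by
    filter_upwards [lt_mem_nhds hm0] with s hs using hmax s hs.le
  have hd : ∀ {Ω : ℝ → ℝ}, IsMKOSolution Ω → ∀ s, 0 < s →
      DifferentiableAt ℝ Ω s ∧ DifferentiableAt ℝ (deriv Ω) s := by
    intro Ω hΩ s hs
    have h1 := hΩ.contDiffOn
    refine ⟨(h1.differentiableOn two_ne_zero).differentiableAt (Ioi_mem_nhds hs), ?_⟩
    exact ((h1.deriv_of_isOpen (m := 1) isOpen_Ioi (by norm_num)).differentiableOn
      one_ne_zero).differentiableAt (Ioi_mem_nhds hs)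
  have hderiv : deriv D =ᶠ[𝓝 m] fun s => deriv Ω₁ s - deriv Ω₂ s := by
    filter_upwards [lt_mem_nhds hm0] with s hs
    exact deriv_fun_sub (hd h₁ s hs).1 (hd h₂ s hs).1
  have hD1 : deriv Ω₁ m - deriv Ω₂ m = 0 := by
    rw [← hderiv.eq_of_nhds]; exact hloc.deriv_eq_zero
  have hexp : ∀ {Ω : ℝ → ℝ}, IsMKOSolution Ω →
      deriv (fun s => s * deriv Ω s) m = deriv Ω m + m * deriv (deriv Ω) m := by
    intro Ω hΩ
    rw [deriv_fun_mul differentiableAt_fun_id (hd hΩ m hm0).2]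
    simp
  have e₁ := h₁.ode m hm0
  have e₂ := h₂.ode m hm0
  rw [hexp h₁] at e₁
  rw [hexp h₂] at e₂
  have hD2 : deriv (deriv D) m = (4 / m ^ 2 - h m) * D m := by
    rw [hderiv.deriv_eq, deriv_fun_sub (hd h₁ m hm0).2 (hd h₂ m hm0).2]
    have e₃ : -(1 / m) * (deriv Ω₁ m - deriv Ω₂ m) -
        (deriv (deriv Ω₁) m - deriv (deriv Ω₂) m) + (4 / m ^ 2 - h m) * D m = 0 := by
      have : 1 / m * m = 1 := by field_simp
      simp only [hD]
      linear_combination e₁ - e₂ + (deriv (deriv Ω₁) m - deriv (deriv Ω₂) m) * this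
    rw [hD1] at e₃
    linarith
  have hpos : 0 < deriv (deriv D) m := by
    rw [hD2]; exact mul_pos (sub_pos.2 (h_lt_four_div_sq hm0)) hDm
  -- A critical point with D'' > 0 is a local minimum; being also a maximum, D is locally constant,
  -- which contradicts D'' > 0.
  have hmin : IsLocalMin D m := isLocalMin_of_deriv_deriv_pos hpos hloc.deriv_eq_zero
    (hDc.continuousAt (Ici_mem_nhds hm0))
  have hconst : D =ᶠ[𝓝 m] fun _ => D m := by
    filter_upwards [hloc, hmin] with s h1 h2 using le_antisymm h1 h2
  have : deriv (deriv D) m = 0 := by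
    rw [hconst.deriv.deriv_eq]; simp
  exact hpos.ne' this

/-! ### The angular Biot–Savart integral -/

theorem integral_sin_mul_poisson_of_lt {m R : ℝ} (hm : 0 < m) (hR : m < R) (θ : ℝ) :
    ∫ α in (-π)..π, sin (2 * α) * (m * R * sin (α - θ) / (R ^ 2 + m ^ 2 - 2 * m * R * cos (α - θ)))
      = π * (m / R) ^ 2 * cos (2 * θ) := by
  have hR0 : 0 < R := hm.trans hR
  set w : ℂ := m * Complex.exp (θ * Complex.I) with hw
  -- Chosen so that Re f = cos(α + θ) - cos(3α - θ) = 2 sin(2α) sin(α - θ) on |z| = R; the Poisson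
  -- formula then evaluates the integral as a multiple of Re f(w).
  set f : ℂ → ℂ := fun z => Complex.exp (θ * Complex.I) / R * z -
    Complex.exp (-(θ * Complex.I)) / R ^ 3 * z ^ 3 with hf
  have hwn : ‖w‖ = m := by
    rw [hw, norm_mul, Complex.norm_exp_ofReal_mul_I, mul_one, Complex.norm_real,
      Real.norm_of_nonneg hm.le]
  have hP := DiffContOnCl.circleAverage_poissonKernel_smul' (c := 0) (w := w) (R := R) (f := f)
    (Differentiable.diffContOnCl (by fun_prop)) (by simpa [hwn] using hR)
  rw [Real.circleAverage_def] at hP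
  simp only [sub_zero, hwn] at hP
  have hper : Function.Periodic (fun α => sin (2 * α) *
      (m * R * sin (α - θ) / (R ^ 2 + m ^ 2 - 2 * m * R * cos (α - θ)))) (2 * π) := by
    intro α
    simp only [mul_add, add_sub_right_comm, sin_add_two_pi, cos_add_two_pi]
    rw [show 2 * (2 * π) = 2 * π + 2 * π by ring, ← add_assoc, sin_add_two_pi, sin_add_two_pi]
  have hshift := hper.intervalIntegral_add_eq (-π) 0
  rw [show -π + 2 * π = π by ring, zero_add] at hshift
  rw [hshift]
  have hpt : ∀ α : ℝ, ((((‖circleMap 0 R α‖ ^ 2 - m ^ 2) / ‖circleMap 0 R α - w‖ ^ 2 : ℝ)) •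
      f (circleMap 0 R α)).re = 2 * (R ^ 2 - m ^ 2) / (m * R) * (sin (2 * α) *
      (m * R * sin (α - θ) / (R ^ 2 + m ^ 2 - 2 * m * R * cos (α - θ)))) := by
    intro α
    have h1 : ‖circleMap 0 R α‖ = R := by simp [hR0.le]
    have h2 : ‖circleMap 0 R α - w‖ ^ 2 = R ^ 2 + m ^ 2 - 2 * m * R * cos (α - θ) := by
      rw [← Complex.normSq_eq_norm_sq, Complex.normSq_apply, cos_sub]
      simp [hw, circleMap, Complex.exp_ofReal_mul_I_re, Complex.exp_ofReal_mul_I_im]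
      linear_combination R ^ 2 * sin_sq_add_cos_sq α + m ^ 2 * sin_sq_add_cos_sq θ
    have h3 : (f (circleMap 0 R α)).re = 2 * (sin (2 * α) * sin (α - θ)) := by
      have e1 : f (circleMap 0 R α) = Complex.exp ((α + θ : ℝ) * Complex.I) -
          Complex.exp ((3 * α - θ : ℝ) * Complex.I) := by
        have hRc : (R : ℂ) ≠ 0 := by exact_mod_cast hR0.ne'
        simp only [hf, circleMap, zero_add]
        congr 1
        · push_cast
          rw [add_mul, Complex.exp_add]
          field_simp
        · push_cast
          rw [sub_mul, sub_eq_add_neg, Complex.exp_add, mul_assoc, mul_pow, ← Complex.exp_nat_mul]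
          push_cast
          field_simp
      rw [e1, Complex.sub_re, Complex.exp_ofReal_mul_I_re, Complex.exp_ofReal_mul_I_re,
        cos_sub_cos]
      rw [show (α + θ + (3 * α - θ)) / 2 = 2 * α by ring,
        show (α + θ - (3 * α - θ)) / 2 = -(α - θ) by ring, sin_neg]
      ring
    rw [Complex.smul_re, h1, h2, h3, smul_eq_mul]
    field_simp
  have hre := congrArg Complex.re hP
  rw [Complex.smul_re, ← Complex.reCLM_apply, ← ContinuousLinearMap.intervalIntegral_comp_comm]
    at hre
  · simp only [Complex.reCLM_apply, hpt, intervalIntegral.integral_const_mul, smul_eq_mul] at hre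
    have hfw : (f w).re = (m / R) * (1 - (m / R) ^ 2) * cos (2 * θ) := by
      have e1 : f w =
          ((m / R * (1 - (m / R) ^ 2) : ℝ) : ℂ) * Complex.exp ((2 * θ : ℝ) * Complex.I) := by
        simp only [hf, hw]
        have e2 : Complex.exp (θ * Complex.I) ≠ 0 := Complex.exp_ne_zero _
        have hRc : (R : ℂ) ≠ 0 := by exact_mod_cast hR0.ne'
        rw [show ((2 * θ : ℝ) : ℂ) * Complex.I = θ * Complex.I + θ * Complex.I by push_cast; ring,
          Complex.exp_add, Complex.exp_neg]
        push_cast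
        field_simp
      rw [e1, Complex.re_ofReal_mul, Complex.exp_ofReal_mul_I_re]
    rw [hfw] at hre
    set J := ∫ α in (0 : ℝ)..2 * π, sin (2 * α) *
      (m * R * sin (α - θ) / (R ^ 2 + m ^ 2 - 2 * m * R * cos (α - θ)))
    have hne : R ^ 2 - m ^ 2 ≠ 0 := by nlinarith
    have hπ := pi_pos
    field_simp at hre
    field_simp
    linarith
  · refine Continuous.intervalIntegrable ?_ _ _
    have hne : ∀ α, ‖circleMap 0 R α - w‖ ^ 2 ≠ 0 := by
      intro α h0
      have : circleMap 0 R α = w := by simpa [sub_eq_zero] using h0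
      have := congrArg norm this
      rw [hwn] at this
      simp [abs_of_pos hR0] at this
      linarith
    fun_prop (disch := assumption)

/-- The integrand is symmetric in r and ρ, so the value is governed by (smaller/larger)². Expressing
it through `greenKernel` links the Biot–Savart law to the equation for g. -/
theorem integral_sin_mul_poisson {r ρ : ℝ} (hr : 0 < r) (hρ : 0 < ρ) (hne : r ≠ ρ) (θ : ℝ) :
    ∫ α in (-π)..π, sin (2 * α) * (r * ρ * sin (α - θ) / (r ^ 2 + ρ ^ 2 - 2 * r * ρ * cos (α - θ)))
      = π * (r ^ 2 * greenKernel (r ^ 2 / 4) (ρ ^ 2 / 4) / ρ ^ 2) * cos (2 * θ) := by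
  rcases lt_or_gt_of_ne hne with hlt | hlt
  · have h1 := integral_sin_mul_poisson_of_lt hr hlt θ
    have h2 : max (r ^ 2 / 4) (ρ ^ 2 / 4) = ρ ^ 2 / 4 := max_eq_right (by gcongr)
    rw [greenKernel, h2, div_self (by positivity), one_pow, mul_one, ← div_pow, ← h1]
    simp only [add_comm (r ^ 2)]
  · have h1 := integral_sin_mul_poisson_of_lt hρ hlt θ
    have h2 : max (r ^ 2 / 4) (ρ ^ 2 / 4) = r ^ 2 / 4 := max_eq_left (by gcongr)
    have h3 : r ^ 2 * greenKernel (r ^ 2 / 4) (ρ ^ 2 / 4) / ρ ^ 2 = (ρ / r) ^ 2 := by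
      rw [greenKernel, h2]; field_simp
    rw [h3, ← h1]
    simp only [mul_comm ρ r, mul_right_comm _ ρ r, mul_assoc]

/-! ### Polar coordinates in the plane -/

theorem integral_mul_comp_sq_div_four (F : ℝ → ℝ) :
    ∫ ρ in Ioi (0 : ℝ), ρ * F (ρ ^ 2 / 4) = 2 * ∫ σ in Ioi (0 : ℝ), F σ := by
  have h1 := integral_comp_rpow_Ioi (fun y => F (1 / 4 * y)) two_ne_zero
  have h2 := integral_comp_mul_left_Ioi F 0 (b := 1 / 4) (by norm_num)
  rw [h2] at h1
  norm_num [mul_assoc, integral_const_mul] at h1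
  have h3 : ∀ ρ : ℝ, F (ρ ^ 2 / 4) = F (1 / 4 * ρ ^ 2) := fun ρ => by ring_nf
  simp only [h3]
  norm_num
  linarith

/-- The measure-preserving identification of `ℝ × ℝ` with the plane. -/
def planeEquiv : ℝ × ℝ ≃ᵐ Plane :=
  MeasurableEquiv.finTwoArrow.symm.trans (MeasurableEquiv.toLp 2 (Fin 2 → ℝ))

theorem measurePreserving_planeEquiv : MeasurePreserving planeEquiv :=
  (PiLp.volume_preserving_toLp (Fin 2)).comp
    (volume_preserving_finTwoArrow ℝ).symm

theorem planeEquiv_polarCoord_symm (p : ℝ × ℝ) :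
    planeEquiv (polarCoord.symm p) = polar p.1 p.2 := by
  ext i
  fin_cases i <;> rfl

theorem integral_plane_eq_polar (F : Plane → ℝ) :
    ∫ y, F y = ∫ p in Ioi (0 : ℝ) ×ˢ Ioo (-π) π, p.1 * F (polar p.1 p.2) := by
  rw [← measurePreserving_planeEquiv.integral_comp planeEquiv.measurableEmbedding,
    ← integral_comp_polarCoord_symm]
  simp only [planeEquiv_polarCoord_symm, smul_eq_mul, polarCoord_target]

theorem Integrable.integrableOn_polar {F : Plane → ℝ} (hF : Integrable F) :
    IntegrableOn (fun p : ℝ × ℝ => p.1 * F (polar p.1 p.2)) (Ioi (0 : ℝ) ×ˢ Ioo (-π) π) := by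
  have h1 : Integrable (F ∘ planeEquiv) :=
    (measurePreserving_planeEquiv.integrable_comp_emb planeEquiv.measurableEmbedding).2 hF
  have h2 := (integrableOn_image_iff_integrableOn_abs_det_fderiv_smul volume
    polarCoord.open_target.measurableSet
    (fun p _ => (hasFDerivAt_polarCoord_symm p).hasFDerivWithinAt)
    polarCoord.symm.injOn (F ∘ planeEquiv)).1 h1.integrableOn
  refine h2.congr_fun (fun p hp => ?_) polarCoord.open_target.measurableSet
  simp only [det_fderivPolarCoordSymm, Function.comp, planeEquiv_polarCoord_symm, smul_eq_mul]
  rw [abs_of_pos (hp.1 : 0 < p.1)]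

/-! ### The velocity field of the vorticity -/

theorem norm_perp (x : Plane) : ‖perp x‖ = ‖x‖ := by
  simp [EuclideanSpace.norm_eq, perp, add_comm]

theorem continuous_perp : Continuous perp := by
  unfold perp
  fun_prop

theorem norm_biotSavartIntegrand (w : Plane → ℝ) (x y : Plane) :
    ‖biotSavartIntegrand w x y‖ = |w y| * ‖x - y‖⁻¹ := by
  rw [biotSavartIntegrand, norm_smul, norm_perp, Real.norm_eq_abs, abs_div,
    abs_of_nonneg (sq_nonneg ‖x - y‖)]
  rcases eq_or_ne ‖x - y‖ 0 with h0 | h0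
  · simp [h0]
  · field_simp

theorem integrableOn_norm_inv_ball :
    IntegrableOn (fun x : Plane => ‖x‖⁻¹) (Metric.ball 0 1) := by
  rw [integrableOn_fun_norm_addHaar volume (f := fun r => r⁻¹)]
  refine (integrableOn_const (C := (1 : ℝ)) (by simp)).congr_fun (fun r hr => ?_) measurableSet_Ioo
  simp [mul_inv_cancel₀ hr.1.ne']

/-- The Biot-Savart integral of a Schwartz function converges absolutely. -/
theorem integrable_biotSavartIntegrand (w : 𝓢(Plane, ℝ)) (x : Plane) :
    Integrable (biotSavartIntegrand w x) := by
  obtain ⟨C, hC0, hC⟩ := w.decay 0 0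
  simp only [pow_zero, one_mul, norm_iteratedFDeriv_zero] at hC
  have h1 : Integrable ((Metric.ball (0 : Plane) 1).indicator fun z => ‖z‖⁻¹) :=
    (integrable_indicator_iff Metric.isOpen_ball.measurableSet).2 integrableOn_norm_inv_ball
  -- Near x the bound sup|w| · |x - y|⁻¹ is integrable; elsewhere |x - y|⁻¹ ≤ 1 and |w| dominates.
  have h2 := ((h1.comp_sub_left x).const_mul C).add w.integrable.norm
  refine h2.mono' ?_ (ae_of_all _ fun y => ?_)
  · have hm : Measurable fun y => w y / ‖x - y‖ ^ 2 :=
      w.continuous.measurable.div (by fun_prop)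
    exact hm.aestronglyMeasurable.smul
      (continuous_perp.comp (continuous_const.sub continuous_id)).aestronglyMeasurable
  · rw [norm_biotSavartIntegrand]
    have hw := hC y
    rw [Real.norm_eq_abs] at hw
    simp only [Pi.add_apply, Real.norm_eq_abs]
    by_cases hy : x - y ∈ Metric.ball (0 : Plane) 1
    · rw [indicator_of_mem hy]
      have : |w y| * ‖x - y‖⁻¹ ≤ C * ‖x - y‖⁻¹ := by gcongr
      linarith [abs_nonneg (w y)]
    · rw [indicator_of_notMem hy]
      have h3 : ‖x - y‖⁻¹ ≤ 1 := inv_le_one_of_one_le₀ (by simpa using hy)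
      nlinarith [abs_nonneg (w y)]

theorem inner_biotSavartIntegrand (w : Plane → ℝ) (x y : Plane) :
    inner ℝ x (biotSavartIntegrand w x y) = w y * ((x 0 * y 1 - x 1 * y 0) / ‖x - y‖ ^ 2) := by
  rw [biotSavartIntegrand, inner_smul_right]
  simp only [PiLp.inner_apply, Fin.sum_univ_two, perp]
  simp
  ring

theorem norm_polar_sub_sq (r θ ρ α : ℝ) :
    ‖polar r θ - polar ρ α‖ ^ 2 = r ^ 2 + ρ ^ 2 - 2 * r * ρ * cos (α - θ) := by
  rw [EuclideanSpace.norm_sq_eq]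
  simp [polar, cos_sub]
  linear_combination r ^ 2 * sin_sq_add_cos_sq θ + ρ ^ 2 * sin_sq_add_cos_sq α

/-- After the angular integration and the substitution σ = ρ²/4, the radial integral is `greenOp
dens`, which the fixed-point equation identifies with `amp` - 1. -/
theorem inner_biotSavart_wInf_polar {r : ℝ} (hr : 0 < r) (θ : ℝ) :
    inner ℝ (polar r θ) (biotSavart wInf (polar r θ))
      = 1 / 2 * (1 - amp (r ^ 2 / 4)) * (r ^ 2 * cos (2 * θ)) := by
  have hint := integrable_biotSavartIntegrand wInf (polar r θ)
  have h1 : inner ℝ (polar r θ) (∫ y, biotSavartIntegrand wInf (polar r θ) y)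
      = ∫ y, inner ℝ (polar r θ) (biotSavartIntegrand wInf (polar r θ) y) :=
    (integral_inner hint _).symm
  have hint2 : Integrable fun y => inner ℝ (polar r θ) (biotSavartIntegrand wInf (polar r θ) y) :=
    hint.const_inner _
  have hpolar := Integrable.integrableOn_polar hint2
  have hpt : ∀ ρ α : ℝ, ρ * inner ℝ (polar r θ) (biotSavartIntegrand wInf (polar r θ) (polar ρ α))
      = -(ρ ^ 2 / 4 * (ρ * dens (ρ ^ 2 / 4))) * (sin (2 * α) *
        (r * ρ * sin (α - θ) / (r ^ 2 + ρ ^ 2 - 2 * r * ρ * cos (α - θ)))) := by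
    intro ρ α
    have e : (polar r θ) 0 * (polar ρ α) 1 - (polar r θ) 1 * (polar ρ α) 0
        = r * ρ * sin (α - θ) := by
      simp [polar, sin_sub]; ring
    rw [inner_biotSavartIntegrand, e, norm_polar_sub_sq, wInf_polar]
    ring
  have h2 : ∫ y, inner ℝ (polar r θ) (biotSavartIntegrand wInf (polar r θ) y)
      = π * r ^ 2 * cos (2 * θ) * (1 - amp (r ^ 2 / 4)) := by
    rw [integral_plane_eq_polar, Measure.volume_eq_prod, setIntegral_prod _ hpolar]
    have h3 : ∀ᵐ ρ ∂(volume.restrict (Ioi (0 : ℝ))), (∫ α in Ioo (-π) π,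
        ρ * inner ℝ (polar r θ) (biotSavartIntegrand wInf (polar r θ) (polar ρ α)))
        = -(1 / 4) * π * r ^ 2 * cos (2 * θ) *
          (ρ * (greenKernel (r ^ 2 / 4) (ρ ^ 2 / 4) * dens (ρ ^ 2 / 4))) := by
      -- The angular formula excludes the null set ρ = r, where the kernel is singular.
      have hne : ∀ᵐ ρ ∂(volume.restrict (Ioi (0 : ℝ))), ρ ≠ r :=
        ae_restrict_of_ae (Measure.ae_ne volume r)
      filter_upwards [hne, ae_restrict_mem measurableSet_Ioi] with ρ hρr hρ
      have hρ0 : ρ ≠ 0 := (mem_Ioi.1 hρ).ne'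
      simp only [hpt]
      rw [integral_const_mul, ← integral_Ioc_eq_integral_Ioo,
        ← intervalIntegral.integral_of_le (by linarith [pi_pos]),
        integral_sin_mul_poisson hr hρ hρr.symm θ]
      field_simp
    rw [integral_congr_ae h3, integral_const_mul,
      integral_mul_comp_sq_div_four fun σ => greenKernel (r ^ 2 / 4) σ * dens σ, amp_eq, greenOp]
    ring
  rw [biotSavart, inner_smul_right, h1, h2]
  have := pi_pos
  field_simp

theorem exists_eq_polar (x : Plane) : ∃ θ, x = polar ‖x‖ θ := by
  have hn : ‖x‖ = ‖(⟨x 0, x 1⟩ : ℂ)‖ := by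
    rw [EuclideanSpace.norm_eq, Complex.norm_eq_sqrt_sq_add_sq]
    simp
  refine ⟨Complex.arg ⟨x 0, x 1⟩, ?_⟩
  rw [hn]
  ext i
  fin_cases i <;> simp [polar, Complex.norm_mul_cos_arg, Complex.norm_mul_sin_arg]

theorem inner_biotSavart_wInf (x : Plane) :
    inner ℝ x (biotSavart wInf x) = 1 / 2 * (1 - amp (‖x‖ ^ 2 / 4)) * (x 0 ^ 2 - x 1 ^ 2) := by
  rcases eq_or_ne x 0 with rfl | hx
  · simp
  obtain ⟨θ, hθ⟩ := exists_eq_polar x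
  have h1 := inner_biotSavart_wInf_polar (norm_pos_iff.2 hx) θ
  rw [← hθ] at h1
  rw [h1]
  have h2 : x 0 ^ 2 - x 1 ^ 2 = ‖x‖ ^ 2 * cos (2 * θ) := by
    rw [cos_two_mul']
    conv_lhs => rw [hθ]
    simp [polar]
    ring
  rw [h2]

/-! ### Verification of Λw = ℳG -/

theorem partialDeriv_G (i : Fin 2) (x : Plane) : partialDeriv i G x = -(1 / 2) * G x * x i := by
  have h1 := (hasStrictFDerivAt_norm_sq x).hasFDerivAt
  have h2 : HasFDerivAt G _ x := (((h1.neg.mul_const (4⁻¹ : ℝ)).exp).const_mul (1 / (4 * π)))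
  rw [partialDeriv, h2.fderiv]
  have h3 : inner ℝ x (EuclideanSpace.single i 1) = x i := by
    simp [EuclideanSpace.inner_single_right]
  simp [G, div_eq_mul_inv, h3]
  ring

theorem convect_G (u : Plane → Plane) (x : Plane) :
    convect u G x = -(1 / 2) * G x * inner ℝ x (u x) := by
  simp only [convect, partialDeriv_G, PiLp.inner_apply, Fin.sum_univ_two]
  simp
  ring

theorem calM_G (x : Plane) : calM G x = -(1 / 4) * G x * (x 0 ^ 2 - x 1 ^ 2) := by
  rw [calM, partialDeriv_G, partialDeriv_G]
  ring

theorem convect_eq_fderiv (u : Plane → Plane) (f : Plane → ℝ) (x : Plane) :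
    convect u f x = fderiv ℝ f x (u x) := by
  have : u x = ∑ i : Fin 2, u x i • EuclideanSpace.single i (1 : ℝ) := by
    ext j
    fin_cases j <;> simp [Fin.sum_univ_two]
  conv_rhs => rw [this]
  simp [convect, partialDeriv]

/-- The rotation field annihilates the radial factor, so only x₁x₂ is differentiated. The profile is
handled within [0, ∞), where |x|²/4 takes its values. -/
theorem fderiv_wInf_perp (x : Plane) :
    fderiv ℝ wInf x (perp x) = -(1 / 2) * (x 0 ^ 2 - x 1 ^ 2) * dens (‖x‖ ^ 2 / 4) := by
  have h0 : ∀ i : Fin 2, HasFDerivAt (fun x : Plane => x i) (EuclideanSpace.proj (𝕜 := ℝ) i) x :=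
    fun i => (EuclideanSpace.proj (𝕜 := ℝ) i : Plane →L[ℝ] ℝ).hasFDerivAt
  have hN := ((hasStrictFDerivAt_norm_sq x).hasFDerivAt.mul_const (4⁻¹ : ℝ))
  have hd : HasFDerivWithinAt dens (fderivWithin ℝ dens (Ici 0) (‖x‖ ^ 2 * 4⁻¹)) (Ici 0)
      (‖x‖ ^ 2 * 4⁻¹) :=
    (((contDiffOn_dens 1).differentiableOn (by simp)) _
      (normSq_div_four_mem_Ici x)).hasFDerivWithinAt
  have hr := hd.comp_hasFDerivAt x hN (Eventually.of_forall normSq_div_four_mem_Ici)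
  have hw : HasFDerivAt wInf _ x :=
    ((((h0 0).mul (h0 1)).const_mul (-(1 / 2) : ℝ)).mul hr).congr_of_eventuallyEq
      (Eventually.of_forall fun y => by rw [wInf_apply]; rfl)
  have hp : inner ℝ x (perp x) = 0 := by
    simp [PiLp.inner_apply, Fin.sum_univ_two, perp]; ring
  rw [hw.fderiv]
  simp [hp]
  simp [perp, div_eq_mul_inv]
  ring

theorem convect_vG_wInf (x : Plane) :
    convect vG wInf x = -(1 / 4) * G x * amp (‖x‖ ^ 2 / 4) * (x 0 ^ 2 - x 1 ^ 2) := by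
  rw [convect_eq_fderiv, vG, map_smul, smul_eq_mul, fderiv_wInf_perp]
  rcases eq_or_ne x 0 with rfl | hx
  · simp
  have hn : 0 < ‖x‖ ^ 2 := by have := norm_pos_iff.2 hx; positivity
  have hs : 0 < ‖x‖ ^ 2 / 4 := by positivity
  rw [dens, bose_eq hs.ne', G, neg_div, exp_neg]
  have he : 0 < exp (‖x‖ ^ 2 / 4) - 1 := sub_pos.2 (one_lt_exp_iff.2 hs)
  have hπ := pi_pos
  have hexp := exp_pos (‖x‖ ^ 2 / 4)
  field_simp
  ring

/-- The two terms are g·ℳG and (1 - g)·ℳG. -/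
theorem Lam_wInf (x : Plane) : Lam wInf x = calM G x := by
  rw [Lam, convect_vG_wInf, convect_G, inner_biotSavart_wInf, calM_G]
  ring

end

end BurgersVortex

theorem proposition3p1 :
    ∃ Ω : ℝ → ℝ,
      BurgersVortex.IsMKOSolution Ω ∧
      (∀ Ω₁ : ℝ → ℝ, BurgersVortex.IsMKOSolution Ω₁ → EqOn Ω₁ Ω (Ici 0)) ∧
      ∃ w : 𝓢(BurgersVortex.Plane, ℝ),
        (∀ r θ : ℝ, 0 ≤ r →
          w (BurgersVortex.polar r θ) =
            BurgersVortex.radialVorticity Ω r * sin (2 * θ)) ∧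
        (∀ x : BurgersVortex.Plane,
          Integrable (BurgersVortex.biotSavartIntegrand w x) volume) ∧
        ∀ x : BurgersVortex.Plane,
          BurgersVortex.Lam w x = BurgersVortex.calM BurgersVortex.G x := by
  refine ⟨BurgersVortex.mko, BurgersVortex.isMKOSolution_mko, fun Ω₁ h₁ r hr => ?_,
    BurgersVortex.wInf, fun r θ _ => ?_, BurgersVortex.integrable_biotSavartIntegrand _,
    BurgersVortex.Lam_wInf⟩
  · exact le_antisymm (h₁.le BurgersVortex.isMKOSolution_mko hr)
      (BurgersVortex.isMKOSolution_mko.le h₁ hr)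
  · rw [BurgersVortex.wInf_polar, BurgersVortex.radialVorticity_mko]
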